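/- Let $A$ be a ring with $1\neq 0$, not necessarily commutative or finite, with an involution $*$ (an anti-automorphism of order at most $2$), let $n\ge 0$, and let $F$ be a field. Let $R=\{r\in A : r^*=r\}$. Let $V$ be the free right $A$-module with basis $u_1,\dots,u_n,v_1,\dots,v_n$, and let $h:V\times V\to A$ be the skew-hermitian form (linear in the second variable, $h(y,x)=-h(x,y)^*$) with $h(u_i,u_j)=h(v_i,v_j)=0$ and $h(u_i,v_j)=\delta_{ij}$. Let $U$ be the group of automorphisms of $V$ preserving $h$, let $M=\langle u_1,\dots,u_n\rangle$ and $N=\langle v_1,\dots,v_n\rangle$ be the $A$-spans, let $C$ be the pointwise stabilizer of $M$ in $U$, let $L$ be the group of all $g\in U$ that stabilize $M$ and $N$ globally and satisfy $gu_i\equiv u_i \bmod \langle u_1,\dots,u_{i-1}\rangle$ for $1\le i\le n$, and let $P=C\rtimes L\le U$. For $v\in N$ let $L_v$ be the stabilizer of $v$ in $L$. A linear character of $A^+$ is a group homomorphism $\lambda:A^+\to F^*$; it is called left admissible if the kernel of $a\mapsto\lambda(a+a^*)$ contains no left ideal of $A$ other than $(0)$. For $1\le i\le n$ and $\lambda$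 left admissible, let $V_{i,\lambda}=\mathrm{ind}_{C\rtimes L_{v_i}}^{P}W_i$, where $W_i$ is the one-dimensional $F$-representation of $C\rtimes L_{v_i}$ given by the linear character $g\mapsto\lambda(h(gv_i,v_i))$. For a non-empty subset $D$ of $\{1,\dots,n\}$ and a family $\lambda=(\lambda_i)_{i\in D}$ of left admissible linear characters $A^+\to F^*$, let $V(D,\lambda)=\bigotimes_{i\in D}V_{i,\lambda_i}$ (tensor product over $F$ with diagonal action of $P$). Theorem 5.3. Suppose that the map $\Lambda:A\to R$, $a\mapsto a+a^*$, is surjective. Let $D,D'$ be non-empty subsets of $\{1,\dots,n\}$, and let $\lambda=(\lambda_i)_{i\in D}$ and $\lambda'=(\lambda'_i)_{i\in D'}$ be families of left admissible linear characters $A^+\to F^*$. Then $V(D,\lambda)\cong V(D',\lambda')$ as $P$-modules over $F$ if and only if $D=D'$ and $\lambda_i|_R=\lambda'_i|_R$ for all $i\in D$. -/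

import Mathlib

open scoped TensorProduct

namespace UnipotentRep

noncomputable section

universe u w

/-! ### The skew-hermitian space and its unitary (or symplectic) group -/

/-- The free right `A`-module with basis `u₁, …, uₙ, v₁, …, vₙ`, in coordinates: the left summand
holds the coefficients of the `uᵢ`, the right one those of the `vᵢ`. Right `A`-modules are modules
over `Aᵐᵒᵖ`, so that `(x · a) k = x k * a`. -/
abbrev Vec (A : Type u) (n : ℕ) : Type u := Fin n ⊕ Fin n → A

/-- The group of all automorphisms of the right `A`-module `Vec A n`. -/
abbrev GLV (A : Type u) [Ring A] (n : ℕ) : Type u := Vec A n ≃ₗ[Aᵐᵒᵖ] Vec A n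

/-- The basis vectors `uᵢ`. -/
def uVec (A : Type u) [Ring A] (n : ℕ) (i : Fin n) : Vec A n := Pi.single (Sum.inl i) 1

/-- The basis vectors `vᵢ`. -/
def vVec (A : Type u) [Ring A] (n : ℕ) (i : Fin n) : Vec A n := Pi.single (Sum.inr i) 1

/-- The submodule `M` spanned by all `uᵢ`. -/
def subM (A : Type u) [Ring A] (n : ℕ) : Submodule Aᵐᵒᵖ (Vec A n) :=
  Submodule.span Aᵐᵒᵖ (Set.range (uVec A n))

/-- The submodule `N` spanned by all `vᵢ`. -/
def subN (A : Type u) [Ring A] (n : ℕ) : Submodule Aᵐᵒᵖ (Vec A n) :=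
  Submodule.span Aᵐᵒᵖ (Set.range (vVec A n))

/-- The submodule `⟨u₁, …, uᵢ₋₁⟩`. -/
def flagBelow (A : Type u) [Ring A] (n : ℕ) (i : Fin n) : Submodule Aᵐᵒᵖ (Vec A n) :=
  Submodule.span Aᵐᵒᵖ (uVec A n '' {j | j < i})

variable {A : Type u} [Ring A] [StarRing A] {n : ℕ}

/-- The skew-hermitian form `h` on `Vec A n`, linear in the second variable, whose Gram matrix on
the basis `u₁, …, uₙ, v₁, …, vₙ` is `(0, 1; -1, 0)`. -/
def form (x y : Vec A n) : A :=
  ∑ i : Fin n, (star (x (Sum.inl i)) * y (Sum.inr i) - star (x (Sum.inr i)) * y (Sum.inl i))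

lemma form_add_left (x y z : Vec A n) : form (x + y) z = form x z + form y z := by
  simp only [form, Pi.add_apply, star_add, add_mul, ← Finset.sum_add_distrib]
  exact Finset.sum_congr rfl fun i _ => by abel

lemma form_add_right (x y z : Vec A n) : form x (y + z) = form x y + form x z := by
  simp only [form, Pi.add_apply, mul_add, ← Finset.sum_add_distrib]
  exact Finset.sum_congr rfl fun i _ => by abel

lemma form_uVec (x : Vec A n) (i : Fin n) : form x (uVec A n i) = -star (x (Sum.inr i)) := by
  simp only [form, uVec]
  rw [Finset.sum_eq_single i]
  · simp
  · intro j _ hj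
    simp [hj]
  · simp

lemma mem_subM_iff {A : Type u} [Ring A] {n : ℕ} (x : Vec A n) :
    x ∈ subM A n ↔ ∀ i, x (Sum.inr i) = 0 := by
  constructor
  · intro hx i
    induction hx using Submodule.span_induction with
    | mem y hy => obtain ⟨j, rfl⟩ := hy; simp [uVec]
    | zero => rfl
    | add y z _ _ hy hz => simp [hy, hz]
    | smul a y _ hy => simp [hy]
  · intro hx
    have : x = ∑ i : Fin n, MulOpposite.op (x (Sum.inl i)) • uVec A n i := by
      funext k
      rcases k with k | k
      · simp [uVec, Finset.sum_apply, Pi.single_apply]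
      · simp [uVec, Finset.sum_apply, hx]
    rw [this]
    exact Submodule.sum_mem _ fun i _ =>
      Submodule.smul_mem _ _ (Submodule.subset_span ⟨i, rfl⟩)

lemma mem_subN_zero {A : Type u} [Ring A] {n : ℕ} {x : Vec A n} (hx : x ∈ subN A n) (i : Fin n) :
    x (Sum.inl i) = 0 := by
  induction hx using Submodule.span_induction with
  | mem y hy => obtain ⟨j, rfl⟩ := hy; simp [vVec]
  | zero => rfl
  | add y z _ _ hy hz => simp [hy, hz]
  | smul a y _ hy => simp [hy]

lemma form_subM {x y : Vec A n} (hx : x ∈ subM A n) (hy : y ∈ subM A n) : form x y = 0 := by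
  rw [mem_subM_iff] at hx hy
  simp [form, hx, hy]

lemma form_subN {x y : Vec A n} (hx : x ∈ subN A n) (hy : y ∈ subN A n) : form x y = 0 := by
  simp [form, mem_subN_zero hx, mem_subN_zero hy]

/-- The subgroup `U` of all automorphisms preserving `h` (a unitary group, or a symplectic group
if the involution is trivial). -/
def groupU (A : Type u) [Ring A] [StarRing A] (n : ℕ) : Subgroup (GLV A n) where
  carrier := {g | ∀ x y, form (g x) (g y) = form x y}
  one_mem' _ _ := rfl
  mul_mem' {g g'} hg hg' x y := (hg (g' x) (g' y)).trans (hg' x y)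
  inv_mem' {g} hg x y := by
    have e : ∀ z, g (g⁻¹ z) = z := fun z => g.apply_symm_apply z
    rw [← hg, e, e]

/-- The pointwise stabilizer `C` of `M` in `U`. -/
def groupC (A : Type u) [Ring A] [StarRing A] (n : ℕ) : Subgroup (GLV A n) :=
  groupU A n ⊓ fixingSubgroup (GLV A n) (subM A n : Set (Vec A n))

/-- The global stabilizer of a submodule. -/
def globalStabilizer {A : Type u} [Ring A] {n : ℕ} (X : Submodule Aᵐᵒᵖ (Vec A n)) :
    Subgroup (GLV A n) where
  carrier := {g | ∀ x, g x ∈ X ↔ x ∈ X}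
  one_mem' _ := Iff.rfl
  mul_mem' {g g'} hg hg' x := (hg (g' x)).trans (hg' x)
  inv_mem' {g} hg x := by
    have e : g (g⁻¹ x) = x := g.apply_symm_apply x
    rw [← hg, e]

/-- The global stabilizer `T` of `M` and `N` in `U`. -/
def groupT (A : Type u) [Ring A] [StarRing A] (n : ℕ) : Subgroup (GLV A n) :=
  groupU A n ⊓ (globalStabilizer (subM A n) ⊓ globalStabilizer (subN A n))

lemma map_flagBelow {A : Type u} [Ring A] {n : ℕ} {g : GLV A n} {i : Fin n}
    (hg : ∀ j < i, g (uVec A n j) ∈ flagBelow A n i) {x : Vec A n} (hx : x ∈ flagBelow A n i) :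
    g x ∈ flagBelow A n i := by
  have : flagBelow A n i ≤ (flagBelow A n i).comap (g : Vec A n →ₗ[Aᵐᵒᵖ] Vec A n) := by
    refine Submodule.span_le.2 ?_
    rintro _ ⟨j, hj, rfl⟩
    exact hg j hj
  exact this hx

lemma flagBelow_mono {A : Type u} [Ring A] {n : ℕ} {i j : Fin n} (h : j ≤ i) :
    flagBelow A n j ≤ flagBelow A n i :=
  Submodule.span_mono (Set.image_mono fun _ hk => lt_of_lt_of_le hk h)

lemma uVec_mem_flagBelow {A : Type u} [Ring A] {n : ℕ} {i j : Fin n} (h : j < i) :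
    uVec A n j ∈ flagBelow A n i :=
  Submodule.subset_span ⟨j, h, rfl⟩

lemma map_flagBelow_of_unitri {A : Type u} [Ring A] {n : ℕ} {g : GLV A n}
    (hg : ∀ i, g (uVec A n i) - uVec A n i ∈ flagBelow A n i) (i : Fin n) {x : Vec A n}
    (hx : x ∈ flagBelow A n i) : g x ∈ flagBelow A n i := by
  refine map_flagBelow (fun j hj => ?_) hx
  have := add_mem (flagBelow_mono hj.le (hg j)) (uVec_mem_flagBelow hj)
  rwa [sub_add_cancel] at this

lemma inv_map_flagBelow_of_unitri {A : Type u} [Ring A] {n : ℕ} {g : GLV A n}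
    (hg : ∀ i, g (uVec A n i) - uVec A n i ∈ flagBelow A n i) (i : Fin n) {x : Vec A n}
    (hx : x ∈ flagBelow A n i) : g⁻¹ x ∈ flagBelow A n i := by
  induction i using WellFoundedLT.induction generalizing x with
  | ind i ih =>
    refine map_flagBelow (fun j hj => ?_) hx
    have h1 := flagBelow_mono hj.le (ih j hj (hg j))
    have e : g⁻¹ (g (uVec A n j)) = uVec A n j := g.symm_apply_apply _
    rw [map_sub, e] at h1
    have := sub_mem (uVec_mem_flagBelow (A := A) hj) h1
    rwa [sub_sub_cancel] at this

/-- The subgroup `L` of all `g ∈ T` with `g uᵢ ≡ uᵢ` modulo `⟨u₁, …, uᵢ₋₁⟩` for all `i`. -/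
def groupL (A : Type u) [Ring A] [StarRing A] (n : ℕ) : Subgroup (GLV A n) where
  carrier := {g | g ∈ groupT A n ∧ ∀ i, g (uVec A n i) - uVec A n i ∈ flagBelow A n i}
  one_mem' := ⟨one_mem _, fun i => by simp⟩
  mul_mem' {g g'} hg hg' := ⟨mul_mem hg.1 hg'.1, fun i => by
    have h1 := add_mem (map_flagBelow_of_unitri hg.2 i (hg'.2 i)) (hg.2 i)
    rw [map_sub, sub_add_sub_cancel] at h1
    exact h1⟩
  inv_mem' {g} hg := ⟨inv_mem hg.1, fun i => by
    have h1 := neg_mem (inv_map_flagBelow_of_unitri hg.2 i (hg.2 i))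
    have e : g⁻¹ (g (uVec A n i)) = uVec A n i := g.symm_apply_apply _
    rwa [map_sub, e, neg_sub] at h1⟩

/-- The unipotent group `P = C ⋊ L`, as the subgroup of `U` generated by `C` and `L`. (It is the
internal semidirect product, since `L ≤ T` normalizes `C` and `C ∩ T` is trivial.) -/
def groupP (A : Type u) [Ring A] [StarRing A] (n : ℕ) : Subgroup (GLV A n) :=
  groupC A n ⊔ groupL A n

/-- The stabilizer `L_v` of the vector `v` in `L`. -/
def stabL (v : Vec A n) : Subgroup (GLV A n) :=
  groupL A n ⊓ MulAction.stabilizer (GLV A n) v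

/-- The subgroup `C ⋊ L_v` of `P`. -/
def groupCL (v : Vec A n) : Subgroup (GLV A n) :=
  groupC A n ⊔ stabL v

lemma groupCL_le (v : Vec A n) : groupCL v ≤ groupP A n :=
  sup_le_sup_left inf_le_left _

/-! ### Linear characters -/

lemma groupP_le_groupU : groupP A n ≤ groupU A n :=
  sup_le inf_le_left fun _ hg => hg.1.1

lemma groupCL_map_subM {v : Vec A n} {g : GLV A n} (hg : g ∈ groupCL v) {x : Vec A n}
    (hx : x ∈ subM A n) : g x ∈ subM A n := by
  have : groupCL v ≤ globalStabilizer (subM A n) := by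
    refine sup_le (fun c hc y => ?_) fun l hl => hl.1.1.2.1
    have hfix : ∀ y ∈ subM A n, c y = y := (mem_fixingSubgroup_iff _).1 hc.2
    refine ⟨fun hy => ?_, fun hy => by rwa [hfix y hy]⟩
    have : c y = y := c.injective (hfix _ hy)
    rwa [this] at hy
  exact (this hg x).2 hx

lemma groupC_sub_mem {c : GLV A n} (hc : c ∈ groupC A n) (x : Vec A n) :
    c x - x ∈ subM A n := by
  rw [mem_subM_iff]
  intro i
  have hfix : c (uVec A n i) = uVec A n i :=
    (mem_fixingSubgroup_iff _).1 hc.2 _ (Submodule.subset_span ⟨i, rfl⟩)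
  have h1 : form (c x) (c (uVec A n i)) = form x (uVec A n i) := hc.1 _ _
  rw [hfix, form_uVec, form_uVec, neg_inj, star_inj] at h1
  simp [h1]

lemma groupCL_sub_mem {v : Vec A n} {g : GLV A n} (hg : g ∈ groupCL v) :
    g v - v ∈ subM A n := by
  suffices H : g ∈ groupCL v ∧ g v - v ∈ subM A n from H.2
  unfold groupCL at hg
  rw [← Subgroup.closure_eq (groupC A n), ← Subgroup.closure_eq (stabL v),
    ← Subgroup.closure_union] at hg
  induction hg using Subgroup.closure_induction with
  | mem x hx =>
    rcases hx with hx | hx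
    · exact ⟨(le_sup_left : groupC A n ≤ groupCL v) hx, groupC_sub_mem hx v⟩
    · refine ⟨(le_sup_right : stabL v ≤ groupCL v) hx, ?_⟩
      have : x v = v := hx.2
      simp [this]
  | one => exact ⟨one_mem _, by simp⟩
  | mul x y _ _ hx hy =>
    refine ⟨mul_mem hx.1 hy.1, ?_⟩
    have := add_mem (groupCL_map_subM hx.1 hy.2) hx.2
    rwa [map_sub, sub_add_sub_cancel] at this
  | inv x _ hx =>
    refine ⟨inv_mem hx.1, ?_⟩
    have h1 := neg_mem (groupCL_map_subM (inv_mem hx.1) hx.2)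
    have e : x⁻¹ (x v) = v := x.symm_apply_apply v
    rwa [map_sub, e, neg_sub] at h1

lemma form_mul_apply {v : Vec A n} (hv : v ∈ subN A n) {g g' : GLV A n} (hg : g ∈ groupCL v)
    (hg' : g' ∈ groupCL v) : form ((g * g') v) v = form (g v) v + form (g' v) v := by
  have key : ∀ x y : GLV A n, x ∈ groupCL v → form (x (y v)) v = form (y v) (x⁻¹ v) := by
    intro x y hx
    have h1 : form (x (y v)) (x (x⁻¹ v)) = form (y v) (x⁻¹ v) :=
      groupP_le_groupU (groupCL_le v hx) _ _
    have e : x (x⁻¹ v) = v := x.apply_symm_apply v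
    rwa [e] at h1
  have h0 : form v v = 0 := form_subN hv hv
  have h1 : form (g v) v = form v (g⁻¹ v) := key g 1 hg
  have h2 : form ((g * g') v) v = form (g' v) (g⁻¹ v) := key g g' hg
  have h3 : form (g' v - v) (g⁻¹ v - v) = 0 :=
    form_subM (groupCL_sub_mem hg') (groupCL_sub_mem (inv_mem hg))
  have h4 : form (g' v) (g⁻¹ v) = form (g' v - v + v) (g⁻¹ v - v + v) := by simp
  have h5 : form (g' v) v = form (g' v - v + v) v := by simp
  have h6 : form v (g⁻¹ v) = form v (g⁻¹ v - v + v) := by simp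
  rw [h1, h2, h4, h5, h6]
  simp only [form_add_left, form_add_right, h3, h0]
  abel

variable {F : Type w} [Field F]

/-- A linear character `μ : A⁺ → Fˣ` is left admissible if the kernel of the linear character
`a ↦ μ (a + a*)` contains no left ideal other than `0`. (`Ideal A` is the type of left ideals.) -/
def LeftAdmissible (μ : AddChar A Fˣ) : Prop :=
  ∀ I : Ideal A, (∀ a ∈ I, μ (a + star a) = 1) → I = ⊥

/-- The linear character `g ↦ μ (h (g v, v))` of `C ⋊ L_v`, where `v ∈ N`. -/
def chi (v : Vec A n) (hv : v ∈ subN A n) (μ : AddChar A Fˣ) : groupCL v →* Fˣ where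
  toFun g := μ (form (g.1 v) v)
  map_one' := by
    have : form ((1 : GLV A n) v) v = 0 := form_subN hv hv
    change μ (form ((1 : GLV A n) v) v) = 1
    rw [this, AddChar.map_zero_eq_one]
  map_mul' g g' := by
    rw [Subgroup.coe_mul, form_mul_apply hv g.2 g'.2, AddChar.map_add_eq_mul]

/-! ### The modules -/

/-- The one-dimensional representation on which `G` acts through the linear character `χ`. -/
def charRep {G : Type*} [Group G] (χ : G →* Fˣ) : Representation F G F where
  toFun g := (χ g : F) • LinearMap.id
  map_one' := by ext; simp
  map_mul' g g' := by ext; simp [mul_comm]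

/-- The tensor product of a family of representations of `G`, with the diagonal action. -/
def piTensorRep {G : Type*} [Group G] {ι : Type*} {W : ι → Type*} [∀ i, AddCommGroup (W i)]
    [∀ i, Module F (W i)] (ρ : ∀ i, Representation F G (W i)) :
    Representation F G (⨂[F] i, W i) :=
  PiTensorProduct.mapMonoidHom.comp (MonoidHom.pi ρ)

lemma vVec_mem_subN {A : Type u} [Ring A] {n : ℕ} (i : Fin n) : vVec A n i ∈ subN A n :=
  Submodule.subset_span ⟨i, rfl⟩

/-- The one-dimensional representation of `C ⋊ L_{vᵢ}` given by `g ↦ μ (h (g vᵢ, vᵢ))`. -/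
def repW (i : Fin n) (μ : AddChar A Fˣ) : Representation F (groupCL (vVec A n i)) F :=
  charRep (chi (vVec A n i) (vVec_mem_subN i) μ)

/-- The underlying space of `V_{i, μ}`. -/
abbrev SpaceV (i : Fin n) (μ : AddChar A Fˣ) : Type (max u w) :=
  Representation.IndV (Subgroup.inclusion (groupCL_le (vVec A n i))) (repW i μ)

/-- The `P`-module `V_{i, μ}`, induced from the one-dimensional representation of
`C ⋊ L_{vᵢ}`. -/
def repV (i : Fin n) (μ : AddChar A Fˣ) : Representation F (groupP A n) (SpaceV i μ) :=
  Representation.ind (Subgroup.inclusion (groupCL_le (vVec A n i))) (repW i μ)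

/-- The `P`-module `V(D, lam)`, the tensor product over `i ∈ D` of the modules
`V_{i, lam i}`. -/
def repVD (D : Finset (Fin n)) (lam : D → AddChar A Fˣ) :
    Representation F (groupP A n) (⨂[F] i : D, SpaceV i.1 (lam i)) :=
  piTensorRep fun i : D => repV i.1 (lam i)

/-- The map `Λ : A → R`, `a ↦ a + a*`, where `R` is the additive group of all hermitian elements
of `A`. -/
def Lam (A : Type u) [Ring A] [StarRing A] (a : A) : selfAdjoint A :=
  ⟨a + star a, IsSelfAdjoint.add_star_self a⟩

end

end UnipotentRep

/-!
The proof restricts both modules to the abelian normal subgroup `C` and compares weights, that is,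
the linear characters through which `C` acts on common eigenvectors.

The module `V_{i, μ}` is spanned by vectors indexed by `g ∈ P`, on which `c ∈ C` acts as
`μ (h (c x, x))` with `x = g⁻¹ vᵢ` (`repV_groupC_indVec`). Consequently `V(D, lam)` is spanned by
pure tensors of such vectors, which are weight vectors for the product characters
(`repVD_groupC_tprod`). An eigenvector of a commuting family cannot have a weight missing from a
spanning family of weight vectors (`exists_weight_eq_of_span_eq_top`). So, given an isomorphism, the
weight of the nonzero tensor of the generators `1 ⊗ 1` of `V(D, lam)`, for which `xᵢ = vᵢ` for
all `i`, is also the weight of some family `(xᵢ)` belonging to `V(D', lam')`.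

The group `C` consists of the maps `siegel S` with `S` a hermitian matrix, and on the element given
by `S = a Eⱼₖ + a* Eₖⱼ` a weight takes the value `∏ᵢ μᵢ (b + b*)` with `b = (xᵢ)ⱼ* a (xᵢ)ₖ`, where
`(xᵢ)ⱼ` is the coefficient of `vⱼ`. Since `P` acts unitriangularly on the `vᵢ` modulo `M`
(`groupP_vVec_apply_inr`), these values can be compared by induction on `j`
(`eq_of_prod_trace_eq`): the entry `k = j` decides whether `j ∈ D'` and what `lam'ⱼ` is on the
elements `a + a*`, and the entries `k ≠ j` then force `xⱼ = vⱼ` modulo `M` by admissibility, so that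
the factor of index `j` does not disturb the later steps. Surjectivity of `Λ` turns
this into equality on `R`.

Conversely, `h (g vᵢ, vᵢ)` is hermitian for `g ∈ C ⋊ L_{vᵢ}`, so the inducing representation depends
only on the restriction of `μ` to `R` (`chi_congr`).
-/

namespace UnipotentRep

noncomputable section

universe u w

/-! ### Weights of spanning families -/

/-- If a space is spanned by common eigenvectors `e κ` of a family of operators, then each common
eigenvector `x ≠ 0` has the same eigenvalues as one of the `e κ`. -/
lemma exists_weight_eq_of_span_eq_top {F V ι κ : Type*} [Field F] [AddCommGroup V] [Module F V]
    (T : ι → V →ₗ[F] V) (e : κ → V) (he : Submodule.span F (Set.range e) = ⊤)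
    (ψ : κ → ι → F) (hψ : ∀ k c, T c (e k) = ψ k c • e k)
    (φ : ι → F) {x : V} (hx : x ≠ 0) (hφ : ∀ c, T c x = φ c • x) : ∃ k, ψ k = φ := by
  classical
  by_contra! hne
  have key : ∀ s : Finset κ, x ∉ Submodule.span F (e '' s) := by
    intro s
    induction s using Finset.induction_on with
    | empty => simpa using hx
    | insert k s _ ih =>
      intro hmem
      rw [Finset.coe_insert, Set.image_insert_eq, Submodule.mem_span_insert] at hmem
      obtain ⟨a, y, hy, hxy⟩ := hmem
      obtain ⟨c, hc⟩ := Function.ne_iff.1 (hne k)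
      have hTy : T c y ∈ Submodule.span F (e '' s) := by
        have : Submodule.span F (e '' s) ≤ (Submodule.span F (e '' s)).comap (T c) := by
          refine Submodule.span_le.2 ?_
          rintro _ ⟨l, hl, rfl⟩
          rw [SetLike.mem_coe, Submodule.mem_comap, hψ]
          exact Submodule.smul_mem _ _ (Submodule.subset_span ⟨l, hl, rfl⟩)
        exact this hy
      -- `T c - ψ k c` kills `e k` and multiplies `x` by a nonzero scalar.
      have h1 : (φ c - ψ k c) • x = T c y - ψ k c • y := by
        have h2 : T c x = a • ψ k c • e k + T c y := by rw [hxy, map_add, map_smul, hψ]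
        rw [sub_smul, ← hφ, h2, hxy, smul_add, smul_comm a]
        abel
      refine ih ((Submodule.smul_mem_iff _ (sub_ne_zero.2 hc.symm)).1 ?_)
      rw [h1]
      exact sub_mem hTy (Submodule.smul_mem _ _ hy)
  have hx' : x ∈ Submodule.span F (Set.range e) := he ▸ Submodule.mem_top
  obtain ⟨t, ht, hxt⟩ := Submodule.mem_span_finite_of_mem_span hx'
  obtain ⟨s, -, rfl⟩ := Finset.subset_set_image_iff.1 (Set.image_univ ▸ ht)
  exact key s (by simpa using hxt)

/-! ### Induction of linear characters and tensor products -/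

section Induction

variable {F : Type*} [Field F] {G H : Type*} [Group G] [Group H] (φ : G →* H) (χ : G →* Fˣ)

lemma span_range_indV_mk :
    Submodule.span F (Set.range fun h : H => Representation.IndV.mk φ (charRep χ) h 1) = ⊤ := by
  rw [← (Submodule.span F _).ker_mkQ, LinearMap.ker_eq_top]
  refine Representation.IndV.hom_ext _ _ fun h => LinearMap.ext_ring ?_
  exact (Submodule.Quotient.mk_eq_zero _).2 (Submodule.subset_span ⟨h, rfl⟩)

lemma indV_mk_map_mul (g : G) (h : H) :
    Representation.IndV.mk φ (charRep χ) (φ g * h) 1 =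
      ((χ g⁻¹ : Fˣ) : F) • Representation.IndV.mk φ (charRep χ) h 1 := by
  have h1 := Representation.Coinvariants.mk_self_apply
    (Representation.tprod ((Representation.leftRegular F H).comp φ) (charRep χ)) g
    (MonoidAlgebra.single h 1 ⊗ₜ[F] ((χ g⁻¹ : Fˣ) : F))
  have h2 : charRep χ g ((χ g⁻¹ : Fˣ) : F) = 1 := by simp [charRep]
  rw [Representation.tprod_apply, TensorProduct.map_tmul, h2] at h1
  rw [← map_smul, smul_eq_mul, mul_one]
  simpa using h1

/-- The functional on the induced module used here extends `g ↦ χ g⁻¹` by zero outside of the image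
of `φ`. -/
lemma indV_mk_one_dual (hφ : Function.Injective φ) :
    ∃ f : Representation.IndV φ (charRep χ) →ₗ[F] F,
      f (Representation.IndV.mk φ (charRep χ) 1 1) = 1 := by
  classical
  let q : H → F := Function.extend φ (fun g => ((χ g⁻¹ : Fˣ) : F)) 0
  have hq : ∀ g h, q (φ g * h) * χ g = q h := by
    intro g h
    by_cases hh : ∃ g', φ g' = h
    · obtain ⟨g', rfl⟩ := hh
      simp only [q, ← map_mul, hφ.extend_apply]
      simp [mul_comm]
    · have hh' : ¬ ∃ g', φ g' = φ g * h := by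
        rintro ⟨g', hg'⟩
        exact hh ⟨g⁻¹ * g', by simp [hg']⟩
      simp only [q, Function.extend_apply' _ _ _ hh, Function.extend_apply' _ _ _ hh']
      simp
  let f₀ : MonoidAlgebra F H →ₗ[F] F →ₗ[F] F :=
    (Finsupp.lift _ F _ fun h => q h • LinearMap.id) ∘ₗ
      (MonoidAlgebra.coeffLinearEquiv F).toLinearMap
  have hf₀ : ∀ h a, f₀ (MonoidAlgebra.single h 1) a = q h * a := by
    intro h a
    simp [f₀]
  refine ⟨Representation.Coinvariants.lift _ (TensorProduct.lift f₀) fun g => ?_, ?_⟩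
  · refine TensorProduct.ext <| MonoidAlgebra.lhom_ext' fun h => LinearMap.ext_ring <|
      LinearMap.ext_ring ?_
    have h1 : (Representation.leftRegular F H) (φ g) (MonoidAlgebra.single h 1) =
        MonoidAlgebra.single (φ g * h) 1 := by simp
    simpa [charRep, h1, hf₀] using hq g h
  · have h1 : q 1 = 1 := by
      rw [← map_one φ]
      simp only [q, hφ.extend_apply]
      simp
    simp [hf₀, h1]

lemma tprod_ne_zero_of_dual {ι : Type*} [Fintype ι] {W : ι → Type*}
    [∀ i, AddCommGroup (W i)] [∀ i, Module F (W i)] (x : ∀ i, W i)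
    (hx : ∀ i, ∃ f : W i →ₗ[F] F, f (x i) = 1) : PiTensorProduct.tprod F x ≠ 0 := by
  choose f hf using hx
  intro h0
  have h1 := congrArg (PiTensorProduct.lift
    ((MultilinearMap.mkPiAlgebra F ι F).compLinearMap f)) h0
  simp [hf] at h1

end Induction

lemma piTensorRep_tprod {F G ι : Type*} [Field F] [Group G] {W : ι → Type*}
    [∀ i, AddCommGroup (W i)] [∀ i, Module F (W i)] (ρ : ∀ i, Representation F G (W i)) (g : G)
    (x : ∀ i, W i) :
    piTensorRep ρ g (PiTensorProduct.tprod F x) = PiTensorProduct.tprod F fun i => ρ i g (x i) :=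
  PiTensorProduct.map_tprod _ _

variable {A : Type u} [Ring A] [StarRing A] {n : ℕ}

/-! ### The action of `P` on the flag and on the vectors `vᵢ` -/

lemma groupP_le_groupCL_zero : groupP A n ≤ groupCL (0 : Vec A n) :=
  sup_le_sup_left (fun g hg => ⟨hg, map_zero g⟩) _

lemma groupP_map_subM {g : GLV A n} (hg : g ∈ groupP A n) {x : Vec A n} (hx : x ∈ subM A n) :
    g x ∈ subM A n :=
  groupCL_map_subM (groupP_le_groupCL_zero hg) hx

lemma groupC_apply_subM {c : GLV A n} (hc : c ∈ groupC A n) {x : Vec A n} (hx : x ∈ subM A n) :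
    c x = x :=
  (mem_fixingSubgroup_iff _).1 hc.2 x hx

lemma conj_mem_groupC {g c : GLV A n} (hg : g ∈ groupP A n) (hc : c ∈ groupC A n) :
    g * c * g⁻¹ ∈ groupC A n := by
  have hgU := groupP_le_groupU hg
  refine ⟨(groupU A n).mul_mem ((groupU A n).mul_mem hgU hc.1) ((groupU A n).inv_mem hgU),
    (mem_fixingSubgroup_iff _).2 fun x hx => ?_⟩
  change g (c (g⁻¹ x)) = x
  rw [groupC_apply_subM hc (groupP_map_subM (inv_mem hg) hx)]
  exact g.apply_symm_apply x

/-- The group of all automorphisms acting unitriangularly on the flag of the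
`⟨u₁, …, uᵢ₋₁⟩`. -/
def flagUnitri (A : Type u) [Ring A] (n : ℕ) : Subgroup (GLV A n) where
  carrier := {g | ∀ i, g (uVec A n i) - uVec A n i ∈ flagBelow A n i}
  one_mem' i := by simp
  mul_mem' {g g'} hg hg' i := by
    have h1 := add_mem (map_flagBelow_of_unitri hg i (hg' i)) (hg i)
    rwa [map_sub, sub_add_sub_cancel] at h1
  inv_mem' {g} hg i := by
    have h1 := neg_mem (inv_map_flagBelow_of_unitri hg i (hg i))
    have e : g⁻¹ (g (uVec A n i)) = uVec A n i := g.symm_apply_apply _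
    rwa [map_sub, e, neg_sub] at h1

lemma groupP_le_flagUnitri : groupP A n ≤ flagUnitri A n := by
  refine sup_le (fun c hc i => ?_) fun g hg => hg.2
  rw [groupC_apply_subM hc (Submodule.subset_span ⟨i, rfl⟩), sub_self]
  exact zero_mem _

lemma flagBelow_apply_eq_zero {A : Type u} [Ring A] {n : ℕ} {i j : Fin n} (hij : j ≤ i)
    {x : Vec A n} (hx : x ∈ flagBelow A n j) : x (Sum.inl i) = 0 := by
  induction hx using Submodule.span_induction with
  | mem y hy =>
    obtain ⟨k, hk, rfl⟩ := hy
    have : i ≠ k := (lt_of_lt_of_le hk hij).ne'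
    simp [uVec, this]
  | zero => rfl
  | add y z _ _ hy hz => simp [hy, hz]
  | smul a y _ hy => simp [hy]

lemma form_vVec_left (x : Vec A n) (i : Fin n) : form (vVec A n i) x = -x (Sum.inl i) := by
  simp only [form, vVec]
  rw [Finset.sum_eq_single i]
  · simp
  · intro j _ hj
    simp [hj]
  · simp

/-- The coefficient of `vⱼ` in `g vᵢ` is, up to `*`, that of `uᵢ` in `g⁻¹ uⱼ`, by invariance of the
form; so unitriangularity on the flag carries over to the `vᵢ`. -/
lemma groupP_vVec_apply_inr {g : GLV A n} (hg : g ∈ groupP A n) {i j : Fin n} (hij : j ≤ i) :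
    g (vVec A n i) (Sum.inr j) = (Pi.single i 1 : Fin n → A) j := by
  have h1 : form (g (vVec A n i)) (g (g⁻¹ (uVec A n j))) = form (vVec A n i) (g⁻¹ (uVec A n j)) :=
    groupP_le_groupU hg _ _
  have e : g (g⁻¹ (uVec A n j)) = uVec A n j := g.apply_symm_apply _
  rw [e, form_uVec, form_vVec_left, neg_inj] at h1
  have h2 := flagBelow_apply_eq_zero hij (groupP_le_flagUnitri (inv_mem hg) j)
  rw [Pi.sub_apply, sub_eq_zero] at h2
  rw [← star_star (g _ _), h1, h2]
  rcases eq_or_ne j i with rfl | hne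
  · simp [uVec]
  · simp [uVec, hne, hne.symm]

/-! ### The elements of `C` given by hermitian matrices -/

open Matrix in
/-- The automorphism fixing all `uⱼ` and mapping `vⱼ` to `vⱼ + ∑ᵢ uᵢ Sᵢⱼ`. -/
def siegel (S : Matrix (Fin n) (Fin n) A) : GLV A n where
  toFun x := x + Sum.elim (S *ᵥ fun k => x (Sum.inr k)) 0
  invFun x := x - Sum.elim (S *ᵥ fun k => x (Sum.inr k)) 0
  map_add' x y := by
    have : (fun k => (x + y) (Sum.inr k)) = (fun k => x (Sum.inr k)) + fun k => y (Sum.inr k) := rfl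
    rw [this, mulVec_add]
    funext k
    rcases k with k | k
    · simp only [Pi.add_apply, Sum.elim_inl]
      abel
    · simp
  map_smul' a x := by
    have : (fun k => (a • x) (Sum.inr k)) = a • fun k => x (Sum.inr k) := rfl
    rw [this, mulVec_smul]
    funext k
    rcases k with k | k <;> simp
  left_inv x := by
    funext k
    rcases k with k | k <;> simp
  right_inv x := by
    funext k
    rcases k with k | k <;> simp

open Matrix in
lemma form_siegel (S : Matrix (Fin n) (Fin n) A) (x y : Vec A n) :
    form (siegel S x) y = form x y +
      star (S *ᵥ fun k => x (Sum.inr k)) ⬝ᵥ fun k => y (Sum.inr k) := by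
  have h1 : siegel S x = x + Sum.elim (S *ᵥ fun k => x (Sum.inr k)) 0 := rfl
  rw [h1, form_add_left]
  simp [form, dotProduct]

open Matrix in
lemma siegel_mem_groupC {S : Matrix (Fin n) (Fin n) A} (hS : S.IsHermitian) :
    siegel S ∈ groupC A n := by
  refine ⟨fun x y => ?_, (mem_fixingSubgroup_iff _).2 fun x hx => ?_⟩
  · have h1 : form x (siegel S y) = form x y -
        star (fun k => x (Sum.inr k)) ⬝ᵥ (S *ᵥ fun k => y (Sum.inr k)) := by
      have h2 : siegel S y = y + Sum.elim (S *ᵥ fun k => y (Sum.inr k)) 0 := rfl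
      rw [h2, form_add_right]
      simp [form, dotProduct, sub_eq_add_neg]
    have h3 : (fun k => siegel S y (Sum.inr k)) = fun k => y (Sum.inr k) :=
      funext fun k => add_zero _
    rw [form_siegel, h1, h3, star_mulVec, hS.eq, dotProduct_mulVec, sub_add_cancel]
  · have h1 : (fun k => x (Sum.inr k)) = 0 := funext fun k => (mem_subM_iff x).1 hx k
    change x + Sum.elim (S *ᵥ fun k => x (Sum.inr k)) 0 = x
    rw [h1, mulVec_zero]
    funext k
    rcases k with k | k <;> simp

/-- The element of `C` with matrix `a Eⱼₖ + a* Eₖⱼ`; for `j = k` the matrix is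
`(a + a*) Eⱼⱼ`. -/
def elemC (j k : Fin n) (a : A) : groupC A n :=
  ⟨siegel (Matrix.single j k a + (Matrix.single j k a).conjTranspose),
    siegel_mem_groupC (Matrix.isHermitian_add_transpose_self _)⟩

lemma form_elemC (j k : Fin n) (a : A) {x : Vec A n} (hx : form x x = 0) :
    form ((elemC j k a).1 x) x = star (x (Sum.inr j)) * a * x (Sum.inr k) +
      star (star (x (Sum.inr j)) * a * x (Sum.inr k)) := by
  change form (siegel _ x) x = _
  rw [form_siegel, hx, zero_add, Matrix.conjTranspose_single, Matrix.add_mulVec, star_add,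
    add_dotProduct, Matrix.single_mulVec, Matrix.single_mulVec]
  simp [Function.update, dotProduct, mul_assoc, add_comm, apply_ite star, ite_mul]

/-! ### The weights of `C` on `V_{i, μ}` and on `V(D, lam)` -/

variable {F : Type w} [Field F]

/-- The character of `C` attached to a vector `x`, namely `c ↦ μ (h (c x, x))`. It is a homomorphism
for isotropic `x`, but only its values matter here. -/
def wt (μ : AddChar A Fˣ) (x : Vec A n) (c : groupC A n) : Fˣ :=
  μ (form (c.1 x) x)

/-- The element `c ∈ C`, regarded as an element of `P`. -/
def toP (c : groupC A n) : groupP A n :=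
  ⟨c.1, (le_sup_left : groupC A n ≤ groupP A n) c.2⟩

/-- The vector `g⁻¹ ⊗ 1` of `V_{i, μ}`. The inverse comes from Mathlib's convention that `P` acts
on the induced module by right translation by inverses. -/
def indVec (i : Fin n) (μ : AddChar A Fˣ) (g : groupP A n) : SpaceV i μ :=
  Representation.IndV.mk (Subgroup.inclusion (groupCL_le (vVec A n i))) (repW i μ) g 1

lemma repV_groupC_indVec (i : Fin n) (μ : AddChar A Fˣ) (g : groupP A n) (c : groupC A n) :
    repV i μ (toP c) (indVec i μ g) =
      ((wt μ (g.1⁻¹ (vVec A n i)) c : Fˣ) : F) • indVec i μ g := by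
  have hc' : g.1 * c.1⁻¹ * g.1⁻¹ ∈ groupCL (vVec A n i) :=
    (le_sup_left : groupC A n ≤ _) (conj_mem_groupC g.2 (inv_mem c.2))
  let c' : groupCL (vVec A n i) := ⟨_, hc'⟩
  have h1 : g * (toP c)⁻¹ = Subgroup.inclusion (groupCL_le (vVec A n i)) c' * g := by
    apply Subtype.ext
    change g.1 * c.1⁻¹ = g.1 * c.1⁻¹ * g.1⁻¹ * g.1
    group
  have h2 : chi (vVec A n i) (vVec_mem_subN i) μ c'⁻¹ = wt μ (g.1⁻¹ (vVec A n i)) c := by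
    have h3 : (c'⁻¹).1 = g.1 * c.1 * g.1⁻¹ := by
      change (g.1 * c.1⁻¹ * g.1⁻¹)⁻¹ = _
      group
    change μ (form ((c'⁻¹).1 _) _) = μ _
    rw [h3, ← groupP_le_groupU (inv_mem g.2)]
    congr 2
    exact g.1.symm_apply_apply _
  unfold indVec repV
  rw [Representation.ind_mk, h1]
  unfold repW
  rw [indV_mk_map_mul, h2]
  rfl

lemma repVD_groupC_tprod {D : Finset (Fin n)} (lam : D → AddChar A Fˣ) (g : D → groupP A n)
    (c : groupC A n) :
    repVD D lam (toP c) (PiTensorProduct.tprod F fun i : D => indVec i.1 (lam i) (g i)) =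
      ((∏ i : D, wt (lam i) ((g i).1⁻¹ (vVec A n i)) c : Fˣ) : F) •
        PiTensorProduct.tprod F fun i : D => indVec i.1 (lam i) (g i) := by
  unfold repVD
  rw [piTensorRep_tprod, Units.coe_prod, ← MultilinearMap.map_smul_univ]
  exact congrArg _ (funext fun i => repV_groupC_indVec _ _ _ _)

lemma span_range_tprod_indVec {D : Finset (Fin n)} (lam : D → AddChar A Fˣ) :
    Submodule.span F (Set.range fun g : D → groupP A n =>
      PiTensorProduct.tprod F fun i : D => indVec i.1 (lam i) (g i)) = ⊤ :=
  PiTensorProduct.submodule_span_eq_top (g := fun i : D => indVec i.1 (lam i))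
    fun _ => span_range_indV_mk _ _

lemma tprod_indVec_one_ne_zero {D : Finset (Fin n)} (lam : D → AddChar A Fˣ) :
    (PiTensorProduct.tprod F fun i : D => indVec i.1 (lam i) 1) ≠ 0 :=
  tprod_ne_zero_of_dual _ fun _ => indV_mk_one_dual _ _ (Subgroup.inclusion_injective _)

lemma form_groupP_vVec_self {g : GLV A n} (hg : g ∈ groupP A n) (i : Fin n) :
    form (g (vVec A n i)) (g (vVec A n i)) = 0 :=
  (groupP_le_groupU hg _ _).trans (form_subN (vVec_mem_subN i) (vVec_mem_subN i))

lemma wt_elemC (μ : AddChar A Fˣ) (g : groupP A n) (i j k : Fin n) (a : A) :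
    wt μ (g.1⁻¹ (vVec A n i)) (elemC j k a) =
      μ (star (g.1⁻¹ (vVec A n i) (Sum.inr j)) * a * g.1⁻¹ (vVec A n i) (Sum.inr k) +
        star (star (g.1⁻¹ (vVec A n i) (Sum.inr j)) * a * g.1⁻¹ (vVec A n i) (Sum.inr k))) := by
  rw [wt, form_elemC j k a (form_groupP_vVec_self (inv_mem g.2) i)]

/-- If `V(D, lam)` and `V(D', lam')` are isomorphic, then the weight of `V(D, lam)` given by the
`vᵢ` themselves equals some weight of `V(D', lam')`. -/
lemma exists_weight_eq_of_equiv {D D' : Finset (Fin n)} {lam : D → AddChar A Fˣ}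
    {lam' : D' → AddChar A Fˣ} (e : (repVD D lam).Equiv (repVD D' lam')) :
    ∃ g : D' → groupP A n, ∀ c : groupC A n,
      ∏ i : D, wt (lam i) (vVec A n i) c =
        ∏ i : D', wt (lam' i) ((g i).1⁻¹ (vVec A n i)) c := by
  obtain ⟨g, hg⟩ := exists_weight_eq_of_span_eq_top (fun c => repVD D' lam' (toP c)) _
    (span_range_tprod_indVec lam') _ (repVD_groupC_tprod lam')
    (fun c => ((∏ i : D, wt (lam i) (vVec A n i) c : Fˣ) : F))
    (x := e.toLinearEquiv (PiTensorProduct.tprod F fun i : D => indVec i.1 (lam i) 1))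
    ((LinearEquiv.map_ne_zero_iff _).2 (tprod_indVec_one_ne_zero lam)) fun c => by
      have h1 := LinearMap.congr_fun (e.isIntertwining' (toP c))
        (PiTensorProduct.tprod F fun i : D => indVec i.1 (lam i) 1)
      have h2 := repVD_groupC_tprod lam (fun _ => 1) c
      refine h1.symm.trans ?_
      rw [LinearMap.comp_apply, h2]
      exact map_smul e.toLinearEquiv _ _
  exact ⟨g, fun c => Units.ext (congrFun hg c).symm⟩

/-! ### Recovering the data from one weight -/

lemma LeftAdmissible.exists_ne_one [Nontrivial A] {μ : AddChar A Fˣ} (hμ : LeftAdmissible μ) :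
    ∃ a, μ (a + star a) ≠ 1 := by
  by_contra! h
  exact top_ne_bot (hμ ⊤ fun a _ => h a)

lemma LeftAdmissible.eq_zero {μ : AddChar A Fˣ} (hμ : LeftAdmissible μ) {b : A}
    (h : ∀ a, μ (a * b + star (a * b)) = 1) : b = 0 := by
  have h1 := hμ (Ideal.span {b}) fun c hc => by
    obtain ⟨a, rfl⟩ := Ideal.mem_span_singleton'.1 hc
    exact h a
  exact Ideal.span_singleton_eq_bot.1 h1

/-- Here `y i` is the coordinate vector of `xᵢ` modulo `M`, and the hypothesis `H` says that the
weight of the family `(xᵢ)` agrees with that of the family `(vᵢ)` on all `elemC j k a`. -/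
lemma eq_of_prod_trace_eq [Nontrivial A] {D D' : Finset (Fin n)} {lam : D → AddChar A Fˣ}
    {lam' : D' → AddChar A Fˣ} (hlam : ∀ i, LeftAdmissible (lam i))
    (hlam' : ∀ i, LeftAdmissible (lam' i)) (y : D' → Fin n → A)
    (hy : ∀ (i : D') (k : Fin n), k ≤ i → y i k = (Pi.single i.1 1 : Fin n → A) k)
    (H : ∀ j k a,
      ∏ i : D, lam i (star ((Pi.single i.1 1 : Fin n → A) j) * a * (Pi.single i.1 1 : Fin n → A) k +
        star (star ((Pi.single i.1 1 : Fin n → A) j) * a * (Pi.single i.1 1 : Fin n → A) k)) =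
      ∏ i : D', lam' i (star (y i j) * a * y i k + star (star (y i j) * a * y i k))) :
    D = D' ∧ ∀ j (hj : j ∈ D) (hj' : j ∈ D') a,
      lam ⟨j, hj⟩ (a + star a) = lam' ⟨j, hj'⟩ (a + star a) := by
  -- The last clause says that `x_j = v_j` modulo `M`.
  have key : ∀ j : Fin n, (j ∈ D ↔ j ∈ D') ∧
      (∀ (hj : j ∈ D) (hj' : j ∈ D') a,
        lam ⟨j, hj⟩ (a + star a) = lam' ⟨j, hj'⟩ (a + star a)) ∧
      ∀ hj' : j ∈ D', ∀ k, k ≠ j → y ⟨j, hj'⟩ k = 0 := by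
    intro j
    induction j using WellFoundedLT.induction with
    | ind j ih =>
      have hyj : ∀ i : D', i.1 ≠ j → y i j = 0 := by
        intro i hij
        rcases lt_or_gt_of_ne hij with h | h
        · exact (ih i h).2.2 i.2 j hij.symm
        · rw [hy i j h.le, Pi.single_eq_of_ne hij.symm]
      -- In both products only the factor of index `j` can differ from `1`.
      have hL : ∀ (hj : j ∈ D) k a,
          ∏ i : D, lam i (star ((Pi.single i.1 1 : Fin n → A) j) * a *
            (Pi.single i.1 1 : Fin n → A) k + star (star ((Pi.single i.1 1 : Fin n → A) j) * a *
              (Pi.single i.1 1 : Fin n → A) k)) =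
          lam ⟨j, hj⟩ (a * (Pi.single j 1 : Fin n → A) k +
            star (a * (Pi.single j 1 : Fin n → A) k)) := by
        intro hj k a
        rw [Fintype.prod_eq_single ⟨j, hj⟩]
        · simp
        · intro i hi
          have : j ≠ i.1 := fun h => hi (Subtype.ext h.symm)
          simp [this]
      have hL0 : ∀ (hj : j ∉ D) k a,
          ∏ i : D, lam i (star ((Pi.single i.1 1 : Fin n → A) j) * a *
            (Pi.single i.1 1 : Fin n → A) k + star (star ((Pi.single i.1 1 : Fin n → A) j) * a *
              (Pi.single i.1 1 : Fin n → A) k)) = 1 := by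
        intro hj k a
        refine Finset.prod_eq_one fun i _ => ?_
        have : j ≠ i.1 := fun h => hj (h ▸ i.2)
        simp [this]
      have hR : ∀ (hj : j ∈ D') k a,
          ∏ i : D', lam' i (star (y i j) * a * y i k + star (star (y i j) * a * y i k)) =
          lam' ⟨j, hj⟩ (a * y ⟨j, hj⟩ k + star (a * y ⟨j, hj⟩ k)) := by
        intro hj k a
        rw [Fintype.prod_eq_single ⟨j, hj⟩]
        · simp [hy ⟨j, hj⟩ j le_rfl]
        · intro i hi
          simp [hyj i fun h => hi (Subtype.ext h)]
      have hR0 : ∀ (hj : j ∉ D') k a,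
          ∏ i : D', lam' i (star (y i j) * a * y i k + star (star (y i j) * a * y i k)) = 1 := by
        intro hj k a
        refine Finset.prod_eq_one fun i _ => ?_
        simp [hyj i fun h => hj (h ▸ i.2)]
      have hyjj : ∀ hj : j ∈ D', y ⟨j, hj⟩ j = 1 := fun hj => by simp [hy ⟨j, hj⟩ j le_rfl]
      have hmem : j ∈ D ↔ j ∈ D' := by
        constructor <;> intro hj <;> by_contra hj'
        · obtain ⟨a, ha⟩ := (hlam ⟨j, hj⟩).exists_ne_one
          have h1 := H j j a
          rw [hL hj, hR0 hj'] at h1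
          simp only [Pi.single_eq_same, mul_one] at h1
          exact ha h1
        · obtain ⟨a, ha⟩ := (hlam' ⟨j, hj⟩).exists_ne_one
          have h1 := H j j a
          rw [hL0 hj', hR hj, hyjj] at h1
          simp only [mul_one] at h1
          exact ha h1.symm
      refine ⟨hmem, fun hj hj' a => ?_, fun hj' k hk => ?_⟩
      · have h1 := H j j a
        rw [hL hj, hR hj', hyjj] at h1
        simpa only [Pi.single_eq_same, mul_one] using h1
      · refine (hlam' ⟨j, hj'⟩).eq_zero fun a => ?_
        have h1 := H j k a
        rw [hL (hmem.2 hj'), hR hj', Pi.single_eq_of_ne hk] at h1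
        rw [← h1]
        simp
  exact ⟨Finset.ext fun j => (key j).1, fun j => (key j).2.1⟩

/-! ### Dependence on the restriction to the hermitian elements -/

/-- Since `g ↦ h (g v, v)` is additive on `C ⋊ L_v`, one has
`h (g v, v) = -h (g⁻¹ v, v) = -h (v, g v) = h (g v, v)*`. -/
lemma form_groupCL_mem_selfAdjoint {v : Vec A n} (hv : v ∈ subN A n) {g : GLV A n}
    (hg : g ∈ groupCL v) : form (g v) v ∈ selfAdjoint A := by
  have h1 : form (g v) v + form (g⁻¹ v) v = 0 := by
    rw [← form_mul_apply hv hg (inv_mem hg), mul_inv_cancel]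
    exact form_subN hv hv
  have h2 : form (g⁻¹ v) v = form v (g v) := by
    rw [← groupP_le_groupU (groupCL_le v hg)]
    congr 1
    exact g.apply_symm_apply v
  have h3 : star (form (g v) v) = -form v (g v) := by
    simp [form, star_sum]
  rw [selfAdjoint.mem_iff, h3, ← h2]
  exact (eq_neg_of_add_eq_zero_left h1).symm

lemma chi_congr {v : Vec A n} (hv : v ∈ subN A n) {μ μ' : AddChar A Fˣ}
    (h : ∀ r ∈ selfAdjoint A, μ r = μ' r) : chi v hv μ = chi v hv μ' :=
  MonoidHom.ext fun g => h _ (form_groupCL_mem_selfAdjoint hv g.2)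

lemma nonempty_equiv_of_inducing_eq {D : Finset (Fin n)}
    {ρ ρ' : ∀ i : D, Representation F (groupCL (vVec A n i)) F} (h : ρ = ρ') :
    Nonempty
      ((piTensorRep fun i : D =>
          Representation.ind (Subgroup.inclusion (groupCL_le (vVec A n i))) (ρ i)).Equiv
        (piTensorRep fun i : D =>
          Representation.ind (Subgroup.inclusion (groupCL_le (vVec A n i))) (ρ' i))) := by
  subst h
  exact ⟨Representation.Equiv.refl _⟩

lemma nonempty_equiv_of_restrict_eq {D : Finset (Fin n)} {lam lam' : D → AddChar A Fˣ}
    (h : ∀ i, ∀ r ∈ selfAdjoint A, lam i r = lam' i r) :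
    Nonempty ((repVD D lam).Equiv (repVD D lam')) :=
  nonempty_equiv_of_inducing_eq (ρ := fun i => repW i.1 (lam i)) (ρ' := fun i => repW i.1 (lam' i))
    (funext fun i => congrArg charRep (chi_congr _ (h i)))

end

end UnipotentRep

theorem theorem5p3 {A : Type*} [Ring A] [Nontrivial A] [StarRing A] {F : Type*} [Field F] {n : ℕ}
    (D D' : Finset (Fin n)) (hD : D.Nonempty) (hD' : D'.Nonempty)
    (lam : D → AddChar A Fˣ) (lam' : D' → AddChar A Fˣ)
    (hlam : ∀ i, UnipotentRep.LeftAdmissible (lam i))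
    (hlam' : ∀ i, UnipotentRep.LeftAdmissible (lam' i))
    (hsurj : Function.Surjective (UnipotentRep.Lam A)) :
    Nonempty ((UnipotentRep.repVD D lam).Equiv (UnipotentRep.repVD D' lam')) ↔
      D = D' ∧ ∀ (i : Fin n) (hi : i ∈ D) (hi' : i ∈ D'), ∀ r ∈ selfAdjoint A,
        lam ⟨i, hi⟩ r = lam' ⟨i, hi'⟩ r := by
  constructor
  · rintro ⟨e⟩
    obtain ⟨g, hg⟩ := UnipotentRep.exists_weight_eq_of_equiv e
    obtain ⟨h1, h2⟩ := UnipotentRep.eq_of_prod_trace_eq hlam hlam'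
      (fun i k => (g i).1⁻¹ (UnipotentRep.vVec A n i) (Sum.inr k))
      (fun i k hk => UnipotentRep.groupP_vVec_apply_inr (inv_mem (g i).2) hk)
      (fun j k a => by
        have h3 := hg (UnipotentRep.elemC j k a)
        simp only [UnipotentRep.wt_elemC] at h3
        rw [← h3]
        refine Finset.prod_congr rfl fun i _ => ?_
        have h4 := UnipotentRep.wt_elemC (lam i) 1 i j k a
        have h5 : ∀ l, (1 : UnipotentRep.groupP A n).1⁻¹ (UnipotentRep.vVec A n i) (Sum.inr l) =
            (Pi.single i.1 1 : Fin n → A) l :=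
          fun l => by simp [UnipotentRep.vVec, Pi.single_apply]
        simp only [h5] at h4
        rw [← h4]
        rfl)
    refine ⟨h1, fun i hi hi' r hr => ?_⟩
    obtain ⟨a, ha⟩ := hsurj ⟨r, hr⟩
    have h3 : a + star a = r := congrArg Subtype.val ha
    rw [← h3]
    exact h2 i hi hi' a
  · rintro ⟨rfl, h⟩
    exact UnipotentRep.nonempty_equiv_of_restrict_eq fun i => h i.1 i.2 i.2
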